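/- Let $F\in\mathbb N$, $\lambda>0$, $P>0$, $\alpha>2$, $c\ge 1$, and for $i=1,\dots,F$ let $f_i\in\mathbb R$ (for instance content popularities), caching probabilities $p_i\in[0,1]$ and target bit rates $\rho_i>0$ be given; put $\tau_i=2^{c\rho_i}-1$. For Nakagami fading with parameters $m_D\in\{1,2,\dots\}$ (desired link) and $m_I\ge\frac12$ (interfering links), the stochastic-geometry lower bound on the average content delivery success probability, with caching helpers forming a planar Poisson process of intensity $\lambda$, transmit power $P$ and path loss exponent $\alpha$, is $$B_{m_D,m_I}=\sum_{i=1}^F f_i\int_0^\infty\sum_{k=0}^{m_D-1}\frac1{k!}\left(-m_DP^{-1}\tau_ir^\alpha\right)^k\,\frac{d^k}{ds^k}\mathcal L_{i,r}(s)\Big|_{s=m_DP^{-1}\tau_ir^\alpha}\;2\pi p_i\lambda r\,e^{-\pi p_i\lambda r^2}\,dr,$$ $$\mathcal L_{i,r}(s)=\exp\!\left(-2\pi\lambda\int_0^\infty\Big[1-\tfrac{m_I^{m_I}}{(sPv^{-\alpha}+m_I)^{m_I}}\Big]v\,dv+2\pi p_i\lambda\int_0^r\Big[1-\tfrac{m_I^{m_I}}{(sPv^{-\alpha}+m_I)^{m_I}}\Big]v\,dv\right).$$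 Then for Rayleigh fading, $m_D=m_I=1$, the inner integrals (for every $s\ge 0$) and the integrals over $r$ converge, and $$B_{1,1}=\sum_{i=1}^F f_i\,\frac{p_i}{\left(1-\tau_i^{2/\alpha}C_{\tau_i,\alpha}\right)p_i+\tau_i^{2/\alpha}C_\alpha},$$ where all denominators are positive, $C_\alpha=\frac{2\pi}{\alpha}\csc\left(\frac{2\pi}{\alpha}\right)$, $C_{\tau,\alpha}=\tau^{-2/\alpha}\,{}_2F_1\!\left(1,\frac2\alpha;1+\frac2\alpha;-\frac1\tau\right)$, and ${}_2F_1$ is the Gauss hypergeometric function (the principal branch, i.e. the holomorphic continuation of the hypergeometric series to $\mathbb C\setminus[1,\infty)$). -/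

import Mathlib

open MeasureTheory Set

/-- The principal branch of the Gauss hypergeometric function `₂F₁(a, b; c; ·)`: the holomorphic
function on the plane cut along `[1, ∞)` that agrees with the hypergeometric series on the open
unit disc. (`1 - z ∈ Complex.slitPlane` says that `z` is not a real number `≥ 1`. The cut plane is
connected, so there is at most one such function on it.) -/
noncomputable def gaussHypergeometricBranch (a b c : ℂ) : ℂ → ℂ :=
  Classical.epsilon fun G : ℂ → ℂ =>
    DifferentiableOn ℂ G {z : ℂ | 1 - z ∈ Complex.slitPlane} ∧
      ∀ z : ℂ, ‖z‖ < 1 → G z = ordinaryHypergeometric a b c z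

/-- The Gauss hypergeometric function `₂F₁(a, b; c; x)` for real parameters and real `x < 1`,
where the principal branch takes real values. -/
noncomputable def gaussHypergeometric (a b c x : ℝ) : ℝ :=
  (gaussHypergeometricBranch (a : ℂ) (b : ℂ) (c : ℂ) (x : ℂ)).re

/-- The threshold `τ = 2 ^ (c ρ) - 1` for the target bit rate `ρ`. -/
noncomputable def sirThreshold (c ρ : ℝ) : ℝ := (2 : ℝ) ^ (c * ρ) - 1

/-- `C_α = (2π/α) csc (2π/α)`. -/
noncomputable def cAlpha (α : ℝ) : ℝ := (2 * Real.pi / α) * (Real.sin (2 * Real.pi / α))⁻¹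

/-- `C_{τ,α} = τ^(-2/α) ₂F₁(1, 2/α; 1 + 2/α; -1/τ)`. -/
noncomputable def cTauAlpha (τ α : ℝ) : ℝ :=
  τ ^ (-(2 / α)) * gaussHypergeometric 1 (2 / α) (1 + 2 / α) (-1 / τ)

/-- The integrand `[1 - E[exp (-s P g v^(-α))]] v`, where the power gain `g` of an interfering link
with Nakagami parameter `mI` has the Laplace transform `x ↦ mI ^ mI / (x + mI) ^ mI`. -/
noncomputable def interferenceIntegrand (mI P α s v : ℝ) : ℝ :=
  (1 - mI ^ mI / (s * P * v ^ (-α) + mI) ^ mI) * v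

/-- The Laplace transform `𝓛_I(s)` of the interference at the typical user, when the nearest helper
storing the requested content (cached with probability `p`) is at distance `r`. -/
noncomputable def interferenceLaplace (mI lam P α p r s : ℝ) : ℝ :=
  Real.exp (-(2 * Real.pi * lam * ∫ v in Ioi (0 : ℝ), interferenceIntegrand mI P α s v)
    + 2 * Real.pi * p * lam * ∫ v in Ioc 0 r, interferenceIntegrand mI P α s v)

/-- The density of the distance to the nearest helper storing a content that is cached with
probability `p`, the helpers forming a planar Poisson process of intensity `lam`. -/
noncomputable def nearestDistanceDensity (lam p r : ℝ) : ℝ :=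
  2 * Real.pi * p * lam * r * Real.exp (-(Real.pi * p * lam * r ^ 2))

/-- The integrand (in the distance `r`) of the lower bound for one content with threshold `τ`. -/
noncomputable def deliveryIntegrand (mD : ℕ) (mI lam P α τ p r : ℝ) : ℝ :=
  (∑ k ∈ Finset.range mD, (1 / (k.factorial : ℝ)) * (-((mD : ℝ) * P⁻¹ * τ * r ^ α)) ^ k *
      iteratedDeriv k (fun s => interferenceLaplace mI lam P α p r s)
        ((mD : ℝ) * P⁻¹ * τ * r ^ α))
    * nearestDistanceDensity lam p r

/-- The lower bound on the average success probability of content delivery over Nakagami fading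
with parameters `mD` (desired link) and `mI` (interfering links). -/
noncomputable def deliveryLowerBound {F : ℕ} (mD : ℕ) (mI lam P α c : ℝ) (f p ρ : Fin F → ℝ) : ℝ :=
  ∑ i, f i * ∫ r in Ioi (0 : ℝ), deliveryIntegrand mD mI lam P α (sirThreshold c (ρ i)) (p i) r

/-! For `m_D = 1` only the term `k = 0` survives, so the Laplace transform is merely evaluated at `s
= τ r^α / P`. With `T = τ r^α` the interference integrand becomes `v T / (T + v^α)`. Its integral
over the half-line is `T^(2/α) C_α / 2`, by two Gamma integrals and the reflection formula
(`integral_mul_div_add_rpow`); its integral up to `r` is `r² / 2` times a value of `₂F₁`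
(`integral_Ioc_mul_div_add_rpow`). Both are multiples of `r²`, so the integrand in `r` is `r` times
a Gaussian and integrates to `p / D`, where `D` is the stated denominator.

The value of `₂F₁` is read off Euler's integral after the substitution `t = w^β`, `β = α/2`. That
integral is holomorphic on the cut plane and sums the series on the disc, so the identity theorem
makes it the principal branch. -/

/-! ### Euler's integral and the principal branch of `₂F₁(1, a; 1 + a; ·)` -/

/-- The slit plane is star-shaped about `1`, and `1 - z x = (1 - x) · 1 + x (1 - z)`. This keeps the
denominator of Euler's integrand away from zero. -/
theorem one_sub_mul_mem_slitPlane {z : ℂ} (hz : 1 - z ∈ Complex.slitPlane) {x : ℝ}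
    (hx : x ∈ Icc (0 : ℝ) 1) : 1 - z * (x : ℂ) ∈ Complex.slitPlane := by
  have h := Complex.starConvex_one_slitPlane hz (a := 1 - x) (b := x) (by linarith [hx.2]) hx.1
    (by ring)
  convert h using 1
  simp only [Complex.real_smul, Complex.ofReal_sub, Complex.ofReal_one]
  ring

/-- The Euler-type integral representing `₂F₁(1, 1/β; 1 + 1/β; z)`. -/
noncomputable def eulerIntegral (β : ℝ) (z : ℂ) : ℂ :=
  ∫ w in (0 : ℝ)..1, (1 - z * ((w ^ β : ℝ) : ℂ))⁻¹

theorem rpow_mem_Icc_zero_one {β w : ℝ} (hβ : 0 < β) (hw : w ∈ uIoc (0 : ℝ) 1) :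
    w ^ β ∈ Icc (0 : ℝ) 1 := by
  rw [uIoc_of_le zero_le_one] at hw
  exact ⟨Real.rpow_nonneg hw.1.le _, Real.rpow_le_one hw.1.le hw.2 hβ.le⟩

theorem isOpen_one_sub_mem_slitPlane : IsOpen {z : ℂ | 1 - z ∈ Complex.slitPlane} :=
  Complex.isOpen_slitPlane.preimage (by fun_prop)

theorem isPreconnected_one_sub_mem_slitPlane :
    IsPreconnected {z : ℂ | 1 - z ∈ Complex.slitPlane} := by
  have h : {z : ℂ | 1 - z ∈ Complex.slitPlane} = (fun z => 1 - z) '' Complex.slitPlane := by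
    ext z
    refine ⟨fun hz => ⟨1 - z, hz, by ring⟩, ?_⟩
    rintro ⟨w, hw, rfl⟩
    simpa using hw
  rw [h]
  exact (Complex.starConvex_one_slitPlane.isPathConnected Complex.one_mem_slitPlane).isConnected.isPreconnected.image _ (by fun_prop)

theorem differentiableOn_eulerIntegral {β : ℝ} (hβ : 0 < β) :
    DifferentiableOn ℂ (eulerIntegral β) {z : ℂ | 1 - z ∈ Complex.slitPlane} := by
  intro z₀ hz₀
  obtain ⟨ε, hε, hball⟩ := Metric.nhds_basis_closedBall.mem_iff.1
    (isOpen_one_sub_mem_slitPlane.mem_nhds hz₀)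
  have hne : ∀ z ∈ Metric.closedBall z₀ ε, ∀ x ∈ Icc (0 : ℝ) 1, 1 - z * (x : ℂ) ≠ 0 :=
    fun z hz x hx => Complex.slitPlane_ne_zero (one_sub_mul_mem_slitPlane (hball hz) hx)
  -- With `x = w ^ β` as an independent variable in `[0, 1]`, the `z`-derivative is continuous on a
  -- compact set; its bound dominates the differentiation under the integral.
  obtain ⟨C, hC⟩ := ((isCompact_closedBall z₀ ε).prod
    (isCompact_Icc (a := (0 : ℝ)) (b := 1))).exists_bound_of_continuousOn
    (f := fun q : ℂ × ℝ => (q.2 : ℂ) / (1 - q.1 * (q.2 : ℂ)) ^ 2) (by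
      refine ContinuousOn.div (by fun_prop) (by fun_prop) ?_
      rintro ⟨z, x⟩ ⟨hz, hx⟩
      exact pow_ne_zero _ (hne z hz x hx))
  have hmeas : ∀ z : ℂ, Measurable fun w : ℝ => (1 - z * ((w ^ β : ℝ) : ℂ))⁻¹ := by
    intro z
    fun_prop
  have hcont : ContinuousOn (fun w : ℝ => (1 - z₀ * ((w ^ β : ℝ) : ℂ))⁻¹) (uIcc 0 1) := by
    refine ContinuousOn.inv₀ ?_ ?_
    · have : Continuous fun w : ℝ => w ^ β := Real.continuous_rpow_const hβ.le
      fun_prop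
    · intro w hw
      rw [uIcc_of_le zero_le_one] at hw
      exact hne z₀ (Metric.mem_closedBall_self hε.le) _
        ⟨Real.rpow_nonneg hw.1 _, Real.rpow_le_one hw.1 hw.2 hβ.le⟩
  have key := intervalIntegral.hasDerivAt_integral_of_dominated_loc_of_deriv_le
    (μ := volume) (a := 0) (b := 1) (𝕜 := ℂ) (bound := fun _ => C)
    (F := fun z w => (1 - z * ((w ^ β : ℝ) : ℂ))⁻¹)
    (F' := fun z w => ((w ^ β : ℝ) : ℂ) / (1 - z * ((w ^ β : ℝ) : ℂ)) ^ 2)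
    (Metric.closedBall_mem_nhds z₀ hε)
    (Filter.Eventually.of_forall fun z => (hmeas z).aestronglyMeasurable)
    hcont.intervalIntegrable
    (by
      refine Measurable.aestronglyMeasurable ?_
      fun_prop)
    (Filter.Eventually.of_forall fun w hw z hz =>
      hC (z, w ^ β) ⟨hz, rpow_mem_Icc_zero_one hβ hw⟩)
    intervalIntegrable_const
    (Filter.Eventually.of_forall fun w hw z hz => by
      have h1 : HasDerivAt (fun z : ℂ => 1 - z * ((w ^ β : ℝ) : ℂ)) (-((w ^ β : ℝ) : ℂ)) z := by
        simpa using ((hasDerivAt_id z).mul_const ((w ^ β : ℝ) : ℂ)).const_sub 1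
      simpa using h1.fun_inv (hne z hz _ (rpow_mem_Icc_zero_one hβ hw)))
  exact key.2.differentiableAt.differentiableWithinAt

/-- Both sides are `a (a + 1) ⋯ (a + n)`. -/
theorem ascPochhammer_eval_add_one_mul (a : ℂ) (n : ℕ) :
    (ascPochhammer ℂ n).eval (1 + a) * a = (ascPochhammer ℂ n).eval a * (a + n) := by
  induction n with
  | zero => simp
  | succ n ih =>
    rw [ascPochhammer_succ_eval, ascPochhammer_succ_eval]
    push_cast
    linear_combination (1 + a + n) * ih

theorem ordinaryHypergeometricCoefficient_one_left {a : ℂ} (ha : ∀ n : ℕ, a + n ≠ 0) (n : ℕ) :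
    ordinaryHypergeometricCoefficient 1 a (1 + a) n = a / (a + n) := by
  have ha0 : a ≠ 0 := by simpa using ha 0
  have hA : (ascPochhammer ℂ n).eval a ≠ 0 := by
    rw [Ne, ascPochhammer_eval_eq_zero_iff]
    rintro ⟨k, -, hk⟩
    exact ha k (by rw [hk]; ring)
  have hB : (ascPochhammer ℂ n).eval (1 + a) ≠ 0 := by
    rw [Ne, ascPochhammer_eval_eq_zero_iff]
    rintro ⟨k, -, hk⟩
    exact ha (k + 1) (by push_cast; rw [hk]; ring)
  have h := ascPochhammer_eval_add_one_mul a n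
  rw [ordinaryHypergeometricCoefficient, ascPochhammer_eval_one,
    inv_mul_cancel₀ (Nat.cast_ne_zero.2 n.factorial_ne_zero), one_mul, ← div_eq_mul_inv,
    div_eq_div_iff hB (ha n), ← h]
  ring

/-- Expand in a geometric series dominated by `‖z‖ ^ n`; the moments `∫ w^(β n) = 1 / (β n + 1)` are
the hypergeometric coefficients. -/
theorem eulerIntegral_eq_ordinaryHypergeometric {β : ℝ} (hβ : 0 < β) {z : ℂ} (hz : ‖z‖ < 1) :
    eulerIntegral β z =
      ordinaryHypergeometric (1 : ℂ) ((β⁻¹ : ℝ) : ℂ) (1 + ((β⁻¹ : ℝ) : ℂ)) z := by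
  have hle : ∀ w ∈ uIoc (0 : ℝ) 1, ‖z * ((w ^ β : ℝ) : ℂ)‖ ≤ ‖z‖ := by
    intro w hw
    have := rpow_mem_Icc_zero_one hβ hw
    rw [norm_mul, Complex.norm_real, Real.norm_of_nonneg this.1]
    exact mul_le_of_le_one_right (norm_nonneg _) this.2
  have hsum : HasSum (fun n : ℕ => ∫ w in (0 : ℝ)..1, (z * ((w ^ β : ℝ) : ℂ)) ^ n)
      (eulerIntegral β z) := by
    refine intervalIntegral.hasSum_integral_of_dominated_convergence (fun n _ => ‖z‖ ^ n)
      (fun n => ?_) (fun n => ?_) ?_ ?_ ?_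
    · refine Measurable.aestronglyMeasurable ?_
      fun_prop
    · refine Filter.Eventually.of_forall fun w hw => ?_
      rw [norm_pow]
      exact pow_le_pow_left₀ (norm_nonneg _) (hle w hw) n
    · exact Filter.Eventually.of_forall fun w hw =>
        summable_geometric_of_lt_one (norm_nonneg _) hz
    · exact intervalIntegrable_const
    · exact Filter.Eventually.of_forall fun w hw =>
        hasSum_geometric_of_norm_lt_one ((hle w hw).trans_lt hz)
  have hterm : ∀ n : ℕ, ∫ w in (0 : ℝ)..1, (z * ((w ^ β : ℝ) : ℂ)) ^ n =
      (ordinaryHypergeometricCoefficient (1 : ℂ) ((β⁻¹ : ℝ) : ℂ) (1 + ((β⁻¹ : ℝ) : ℂ)) n) •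
        z ^ n := by
    intro n
    rw [ordinaryHypergeometricCoefficient_one_left (fun k => by
      have : (0 : ℝ) < β⁻¹ + k := by positivity
      exact_mod_cast this.ne')]
    have h1 : ∀ w ∈ uIcc (0 : ℝ) 1, (z * ((w ^ β : ℝ) : ℂ)) ^ n =
        z ^ n * ((w ^ (β * n) : ℝ) : ℂ) := by
      intro w hw
      rw [uIcc_of_le zero_le_one] at hw
      rw [mul_pow, Real.rpow_mul_natCast hw.1]
      push_cast
      rfl
    have hn : (0 : ℝ) ≤ β * n := by positivity
    rw [intervalIntegral.integral_congr h1, intervalIntegral.integral_const_mul,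
      intervalIntegral.integral_ofReal, integral_rpow (Or.inl (by linarith)),
      Real.one_rpow, Real.zero_rpow (by linarith), smul_eq_mul, mul_comm]
    congr 1
    have h2 : (1 - 0) / (β * n + 1) = β⁻¹ / (β⁻¹ + n) := by
      field_simp
      ring
    rw [h2]
    push_cast
    rfl
  simp only [hterm] at hsum
  rw [ordinaryHypergeometric_eq_tsum]
  exact hsum.tsum_eq.symm

theorem gaussHypergeometricBranch_eq_eulerIntegral {β : ℝ} (hβ : 0 < β) {z : ℂ}
    (hz : 1 - z ∈ Complex.slitPlane) :
    gaussHypergeometricBranch 1 ((β⁻¹ : ℝ) : ℂ) (1 + ((β⁻¹ : ℝ) : ℂ)) z = eulerIntegral β z := by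
  -- The chosen branch has its defining properties only once some function is shown to have them;
  -- Euler's integral is the witness.
  have hspec := Classical.epsilon_spec (p := fun G : ℂ → ℂ =>
    DifferentiableOn ℂ G {z : ℂ | 1 - z ∈ Complex.slitPlane} ∧
      ∀ z : ℂ, ‖z‖ < 1 → G z =
        ordinaryHypergeometric 1 ((β⁻¹ : ℝ) : ℂ) (1 + ((β⁻¹ : ℝ) : ℂ)) z)
    ⟨eulerIntegral β, differentiableOn_eulerIntegral hβ,
      fun z hz => eulerIntegral_eq_ordinaryHypergeometric hβ hz⟩
  have hG := hspec.1.analyticOnNhd isOpen_one_sub_mem_slitPlane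
  have hE := (differentiableOn_eulerIntegral hβ).analyticOnNhd isOpen_one_sub_mem_slitPlane
  refine hG.eqOn_of_preconnected_of_eventuallyEq hE isPreconnected_one_sub_mem_slitPlane
    (z₀ := 0) (by simp) ?_ hz
  filter_upwards [Metric.ball_mem_nhds (0 : ℂ) one_pos] with w hw
  have hw' : ‖w‖ < 1 := by simpa using hw
  exact (hspec.2 w hw').trans (eulerIntegral_eq_ordinaryHypergeometric hβ hw').symm

theorem gaussHypergeometric_neg_eq_integral {a x : ℝ} (ha : 0 < a) (hx : 0 ≤ x) :
    gaussHypergeometric 1 a (1 + a) (-x) = ∫ w in (0 : ℝ)..1, (1 + x * w ^ a⁻¹)⁻¹ := by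
  have h := gaussHypergeometricBranch_eq_eulerIntegral (inv_pos.2 ha) (z := ((-x : ℝ) : ℂ)) (by
    rw [← Complex.ofReal_one, ← Complex.ofReal_sub, Complex.ofReal_mem_slitPlane]
    linarith)
  rw [inv_inv] at h
  rw [gaussHypergeometric, Complex.ofReal_add, Complex.ofReal_one, h, eulerIntegral]
  have h2 : ∀ w : ℝ, (1 - ((-x : ℝ) : ℂ) * ((w ^ a⁻¹ : ℝ) : ℂ))⁻¹ =
      (((1 + x * w ^ a⁻¹)⁻¹ : ℝ) : ℂ) := by
    intro w
    push_cast
    ring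
  simp only [h2]
  rw [intervalIntegral.integral_ofReal, Complex.ofReal_re]

theorem gaussHypergeometric_neg_le_one {a x : ℝ} (ha : 0 < a) (hx : 0 ≤ x) :
    gaussHypergeometric 1 a (1 + a) (-x) ≤ 1 := by
  rw [gaussHypergeometric_neg_eq_integral ha hx, intervalIntegral.integral_of_le zero_le_one]
  refine (integral_mono_of_nonneg (g := fun _ => (1 : ℝ)) ?_ (by simp) ?_).trans (by simp)
  all_goals
    refine (ae_restrict_iff' measurableSet_Ioc).2 (Filter.Eventually.of_forall fun w hw => ?_)
    have : 0 ≤ x * w ^ a⁻¹ := mul_nonneg hx (Real.rpow_nonneg hw.1.le _)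
  · exact inv_nonneg.2 (by linarith)
  · exact inv_le_one_of_one_le₀ (by linarith)

/-! ### The two interference integrals -/

/-- This justifies Fubini. Integrating out `v` leaves a multiple of `y^(-2/α) e^(-T y)`, integrable
at `0` because `2/α < 1`. -/
theorem integrable_mul_exp_prod {α T : ℝ} (hα : 2 < α) (hT : 0 < T) :
    Integrable (fun q : ℝ × ℝ => T * Real.exp (-T * q.2) *
      (q.1 ^ (1 : ℝ) * Real.exp (-q.2 * q.1 ^ α)))
      ((volume.restrict (Ioi 0)).prod (volume.restrict (Ioi 0))) := by
  have ha : 2 / α < 1 := by rw [div_lt_one (by linarith)]; exact hα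
  refine (integrable_prod_iff' (Measurable.aestronglyMeasurable (by fun_prop))).2 ⟨?_, ?_⟩
  · refine (ae_restrict_iff' measurableSet_Ioi).2 (Filter.Eventually.of_forall fun y hy => ?_)
    exact (integrableOn_rpow_mul_exp_neg_mul_rpow (p := α) (s := 1) (b := y) (by norm_num)
      (by linarith) hy).const_mul (T * Real.exp (-T * y))
  · have h := (integrableOn_rpow_mul_exp_neg_mul_rpow (p := 1) (s := -(2 / α)) (b := T)
      (by linarith) one_pos hT).const_mul (T * ((1 / α) * Real.Gamma (2 / α)))
    refine IntegrableOn.congr_fun h (fun y hy => ?_) measurableSet_Ioi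
    have hn : ∀ v ∈ Ioi (0 : ℝ), ‖T * Real.exp (-T * y) * (v ^ (1 : ℝ) * Real.exp (-y * v ^ α))‖ =
        T * Real.exp (-T * y) * (v ^ (1 : ℝ) * Real.exp (-y * v ^ α)) := fun v hv =>
      Real.norm_of_nonneg (by have := Real.rpow_nonneg (le_of_lt hv) 1; positivity)
    rw [setIntegral_congr_fun measurableSet_Ioi hn, integral_const_mul,
      integral_rpow_mul_exp_neg_mul_rpow (by linarith) (by norm_num) hy, Real.rpow_one]
    norm_num [neg_div]
    ring

theorem integral_exp_kernel {α T v : ℝ} (hT : 0 < T) (hv : 0 < v) :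
    ∫ y in Ioi (0 : ℝ), T * Real.exp (-T * y) * (v ^ (1 : ℝ) * Real.exp (-y * v ^ α)) =
      v * (T / (T + v ^ α)) := by
  have hvα : 0 < v ^ α := Real.rpow_pos_of_pos hv α
  have h : ∀ y : ℝ, T * Real.exp (-T * y) * (v ^ (1 : ℝ) * Real.exp (-y * v ^ α)) =
      (T * v) * Real.exp (-(T + v ^ α) * y) := by
    intro y
    rw [show -(T + v ^ α) * y = -T * y + -y * v ^ α by ring, Real.exp_add, Real.rpow_one]
    ring
  simp only [h]
  rw [integral_const_mul, integral_exp_mul_Ioi (by linarith)]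
  simp only [mul_zero, Real.exp_zero]
  field_simp

theorem integrableOn_mul_div_add_rpow {α T : ℝ} (hα : 2 < α) (hT : 0 < T) :
    IntegrableOn (fun v : ℝ => v * (T / (T + v ^ α))) (Ioi 0) :=
  IntegrableOn.congr_fun (integrable_mul_exp_prod hα hT).integral_prod_left
    (fun _ hv => integral_exp_kernel hT hv) measurableSet_Ioi

/-- Write `T / (T + v^α)` as the `y`-integral of `T e^(-T y) e^(-y v^α)` and swap. The inner
integral yields `Γ(2/α)`, the outer `Γ(1 - 2/α)`; reflection turns their product into a cosecant. -/
theorem integral_mul_div_add_rpow {α T : ℝ} (hα : 2 < α) (hT : 0 < T) :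
    ∫ v in Ioi (0 : ℝ), v * (T / (T + v ^ α)) = T ^ (2 / α) * cAlpha α / 2 := by
  have ha : 2 / α < 1 := by rw [div_lt_one (by linarith)]; exact hα
  rw [← setIntegral_congr_fun measurableSet_Ioi (fun v hv => integral_exp_kernel hT hv),
    integral_integral_swap (integrable_mul_exp_prod hα hT)]
  have h : ∀ y ∈ Ioi (0 : ℝ),
      ∫ v in Ioi (0 : ℝ), T * Real.exp (-T * y) * (v ^ (1 : ℝ) * Real.exp (-y * v ^ α)) =
      T * ((1 / α) * Real.Gamma (2 / α)) *
        (y ^ ((1 - 2 / α) - 1) * Real.exp (-(T * y))) := by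
    intro y hy
    rw [integral_const_mul,
      integral_rpow_mul_exp_neg_mul_rpow (by linarith) (by norm_num) hy]
    norm_num [neg_div]
    ring
  rw [setIntegral_congr_fun measurableSet_Ioi h, integral_const_mul,
    Real.integral_rpow_mul_exp_neg_mul_Ioi (by linarith) hT, one_div T,
    Real.inv_rpow hT.le, Real.rpow_sub hT, Real.rpow_one]
  have hG := Real.Gamma_mul_Gamma_one_sub (2 / α)
  have hTa := Real.rpow_pos_of_pos hT (2 / α)
  have hα0 : α ≠ 0 := by linarith
  rw [show T * (1 / α * Real.Gamma (2 / α)) * ((T / T ^ (2 / α))⁻¹ * Real.Gamma (1 - 2 / α)) =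
    T ^ (2 / α) / α * (Real.Gamma (2 / α) * Real.Gamma (1 - 2 / α)) by field_simp, hG, cAlpha,
    show Real.pi * (2 / α) = 2 * Real.pi / α by ring]
  ring

theorem cAlpha_pos {α : ℝ} (hα : 2 < α) : 0 < cAlpha α := by
  have hα0 : 0 < α := by linarith
  have h : 0 < 2 * Real.pi / α := by have := Real.pi_pos; positivity
  refine mul_pos h (inv_pos.2 (Real.sin_pos_of_pos_of_lt_pi h ?_))
  rw [div_lt_iff₀ hα0]
  nlinarith [Real.pi_pos]

theorem integral_Ioc_mul_div_add_rpow {α τ r : ℝ} (hα : 0 < α) (hτ : 0 < τ) (hr : 0 < r) :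
    ∫ v in Ioc 0 r, v * (τ * r ^ α / (τ * r ^ α + v ^ α)) =
      r ^ 2 / 2 * gaussHypergeometric 1 (2 / α) (1 + 2 / α) (-1 / τ) := by
  have hpos : ∀ w : ℝ, 0 ≤ w → 0 < 1 + τ⁻¹ * w ^ (α / 2) := fun w hw => by
    have := Real.rpow_nonneg hw (α / 2)
    positivity
  rw [show -1 / τ = -τ⁻¹ by ring,
    gaussHypergeometric_neg_eq_integral (by positivity) (inv_pos.2 hτ).le, inv_div]
  -- Substitute `w = (v / r)²`; then `dw = 2 v dv / r²` absorbs the factor `v`.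
  have hsub := intervalIntegral.integral_comp_mul_deriv'' (a := 0) (b := r)
    (f := fun v => (v / r) ^ 2) (f' := fun v => 2 * v / r ^ 2)
    (g := fun w => (1 + τ⁻¹ * w ^ (α / 2))⁻¹) (by fun_prop)
    (fun v _ => by
      have := ((hasDerivAt_id v).div_const r).pow 2
      refine (this.congr_deriv ?_).hasDerivWithinAt
      simp
      field_simp)
    (by fun_prop)
    (by
      refine ContinuousOn.inv₀ ?_ ?_
      · have : Continuous fun w : ℝ => w ^ (α / 2) := Real.continuous_rpow_const (by positivity)
        fun_prop
      · rintro _ ⟨v, -, rfl⟩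
        exact (hpos _ (sq_nonneg _)).ne')
  have h0 : ((0 : ℝ) / r) ^ 2 = 0 := by simp
  have h1 : (r / r) ^ 2 = 1 := by rw [div_self hr.ne', one_pow]
  simp only [h0, h1] at hsub
  rw [← hsub, intervalIntegral.integral_of_le hr.le, ← integral_const_mul]
  refine setIntegral_congr_fun measurableSet_Ioc fun v hv => ?_
  have hvr : 0 ≤ v / r := div_nonneg hv.1.le hr.le
  have hrα : 0 < r ^ α := Real.rpow_pos_of_pos hr α
  have hvα : 0 < v ^ α := Real.rpow_pos_of_pos hv.1 α
  have hpow : ((v / r) ^ 2) ^ (α / 2) = v ^ α / r ^ α := by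
    rw [← Real.rpow_natCast, ← Real.rpow_mul hvr, ← Real.div_rpow hv.1.le hr.le]
    congr 1
    push_cast
    ring
  simp only [Function.comp_apply, hpow]
  field_simp

/-! ### Rayleigh fading and the integral over the distance -/

theorem interferenceIntegrand_one_eq {P α s v : ℝ} (hs : 0 ≤ s * P) (hv : 0 < v) :
    interferenceIntegrand 1 P α s v = v * (s * P / (s * P + v ^ α)) := by
  have hvα : 0 < v ^ α := Real.rpow_pos_of_pos hv α
  have h : 0 < s * P + v ^ α := by positivity
  rw [interferenceIntegrand, Real.rpow_one, Real.rpow_one, Real.rpow_neg hv.le]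
  have h' : s * P * (v ^ α)⁻¹ + 1 = (s * P + v ^ α) / v ^ α := by field_simp
  rw [h']
  field_simp
  ring

theorem integrableOn_interferenceIntegrand_one {P α s : ℝ} (hP : 0 < P) (hα : 2 < α)
    (hs : 0 ≤ s) : IntegrableOn (interferenceIntegrand 1 P α s) (Ioi 0) := by
  have hsP : 0 ≤ s * P := by positivity
  refine IntegrableOn.congr_fun ?_
    (fun v hv => (interferenceIntegrand_one_eq (α := α) hsP hv).symm) measurableSet_Ioi
  -- At `s = 0` the integrand vanishes; the kernel formula needs `T > 0`.
  rcases hsP.eq_or_lt with h | h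
  · simp [← h]
  · exact integrableOn_mul_div_add_rpow hα h

theorem interferenceLaplace_one_eq {lam P α p τ r : ℝ} (hP : 0 < P) (hα : 2 < α) (hτ : 0 < τ)
    (hr : 0 < r) :
    interferenceLaplace 1 lam P α p r (P⁻¹ * τ * r ^ α) =
      Real.exp (-(Real.pi * lam * (τ ^ (2 / α) * cAlpha α -
        p * gaussHypergeometric 1 (2 / α) (1 + 2 / α) (-1 / τ)) * r ^ 2)) := by
  have hT : P⁻¹ * τ * r ^ α * P = τ * r ^ α := by field_simp
  have hrα : 0 < r ^ α := Real.rpow_pos_of_pos hr α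
  have hT0 : 0 < τ * r ^ α := by positivity
  have hI : ∀ v : ℝ, 0 < v → interferenceIntegrand 1 P α (P⁻¹ * τ * r ^ α) v =
      v * (τ * r ^ α / (τ * r ^ α + v ^ α)) := fun v hv => by
    rw [interferenceIntegrand_one_eq (by rw [hT]; exact hT0.le) hv, hT]
  have hrr : (r ^ α) ^ (2 / α) = r ^ 2 := by
    rw [← Real.rpow_mul hr.le, mul_div_cancel₀ _ (by linarith), Real.rpow_two]
  rw [interferenceLaplace, setIntegral_congr_fun measurableSet_Ioi fun v hv => hI v hv,
    setIntegral_congr_fun measurableSet_Ioc fun v hv => hI v hv.1,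
    integral_mul_div_add_rpow hα hT0, integral_Ioc_mul_div_add_rpow (by linarith) hτ hr,
    Real.mul_rpow hτ.le hrα.le, hrr]
  congr 1
  ring

theorem deliveryIntegrand_one_one_eq {lam P α τ p r : ℝ} (hP : 0 < P) (hα : 2 < α) (hτ : 0 < τ)
    (hr : 0 < r) :
    deliveryIntegrand 1 1 lam P α τ p r = 2 * Real.pi * p * lam *
      (r ^ (1 : ℝ) * Real.exp (-(Real.pi * lam *
        ((1 - gaussHypergeometric 1 (2 / α) (1 + 2 / α) (-1 / τ)) * p +
          τ ^ (2 / α) * cAlpha α)) * r ^ (2 : ℝ))) := by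
  rw [deliveryIntegrand, Finset.sum_range_one, iteratedDeriv_zero, Nat.cast_one, one_mul,
    interferenceLaplace_one_eq hP hα hτ hr, nearestDistanceDensity, Real.rpow_one, Real.rpow_two]
  simp only [Nat.factorial_zero, Nat.cast_one, div_one, pow_zero, one_mul]
  rw [mul_left_comm, ← Real.exp_add]
  rw [mul_assoc (2 * Real.pi * p * lam)]
  congr 3
  ring

theorem rpow_mul_cTauAlpha {τ : ℝ} (hτ : 0 < τ) (α : ℝ) :
    τ ^ (2 / α) * cTauAlpha τ α = gaussHypergeometric 1 (2 / α) (1 + 2 / α) (-1 / τ) := by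
  rw [cTauAlpha, ← mul_assoc, ← Real.rpow_add hτ, add_neg_cancel, Real.rpow_zero, one_mul]

/-- Euler's integrand is at most `1` at negative arguments, so the coefficient of `p` is
nonnegative; `C_α > 0` gives strictness even at `p = 0`. -/
theorem delivery_denominator_pos {α τ p : ℝ} (hα : 2 < α) (hτ : 0 < τ) (hp : 0 ≤ p) :
    0 < (1 - τ ^ (2 / α) * cTauAlpha τ α) * p + τ ^ (2 / α) * cAlpha α := by
  have hle := gaussHypergeometric_neg_le_one (a := 2 / α) (x := τ⁻¹)
    (div_pos two_pos (by linarith)) (inv_pos.2 hτ).le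
  rw [rpow_mul_cTauAlpha hτ, show -1 / τ = -τ⁻¹ by ring]
  exact add_pos_of_nonneg_of_pos (mul_nonneg (by linarith) hp)
    (mul_pos (Real.rpow_pos_of_pos hτ _) (cAlpha_pos hα))

theorem integrableOn_deliveryIntegrand_one_one {lam P α τ p : ℝ} (hlam : 0 < lam) (hP : 0 < P)
    (hα : 2 < α) (hτ : 0 < τ) (hp : 0 ≤ p) :
    IntegrableOn (deliveryIntegrand 1 1 lam P α τ p) (Ioi 0) := by
  have hD := delivery_denominator_pos hα hτ hp
  rw [rpow_mul_cTauAlpha hτ] at hD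
  exact IntegrableOn.congr_fun
    ((integrableOn_rpow_mul_exp_neg_mul_rpow (by norm_num) two_pos
      (mul_pos (mul_pos Real.pi_pos hlam) hD)).const_mul (2 * Real.pi * p * lam))
    (fun r hr => (deliveryIntegrand_one_one_eq hP hα hτ hr).symm) measurableSet_Ioi

theorem integral_deliveryIntegrand_one_one {lam P α τ p : ℝ} (hlam : 0 < lam) (hP : 0 < P)
    (hα : 2 < α) (hτ : 0 < τ) (hp : 0 ≤ p) :
    ∫ r in Ioi (0 : ℝ), deliveryIntegrand 1 1 lam P α τ p r =
      p / ((1 - τ ^ (2 / α) * cTauAlpha τ α) * p + τ ^ (2 / α) * cAlpha α) := by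
  have hD := delivery_denominator_pos hα hτ hp
  rw [rpow_mul_cTauAlpha hτ] at hD ⊢
  have hb := mul_pos (mul_pos Real.pi_pos hlam) hD
  rw [setIntegral_congr_fun measurableSet_Ioi
    fun r hr => deliveryIntegrand_one_one_eq hP hα hτ hr, integral_const_mul,
    integral_rpow_mul_exp_neg_mul_rpow two_pos (by norm_num) hb]
  rw [show -((1 : ℝ) + 1) / 2 = -1 by norm_num, show ((1 : ℝ) + 1) / 2 = 1 by norm_num,
    Real.Gamma_one, Real.rpow_neg_one]
  have := Real.pi_pos
  field_simp

theorem sirThreshold_pos {c ρ : ℝ} (h : 0 < c * ρ) : 0 < sirThreshold c ρ :=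
  sub_pos.2 (Real.one_lt_rpow one_lt_two h)

theorem corollary1 {F : ℕ} (lam P α c : ℝ) (f p ρ : Fin F → ℝ)
    (hlam : 0 < lam) (hP : 0 < P) (hα : 2 < α) (hc : 1 ≤ c)
    (hρ : ∀ i, 0 < ρ i) (hp0 : ∀ i, 0 ≤ p i) (hp1 : ∀ i, p i ≤ 1) :
    -- all integrals in the bound converge
    (∀ s : ℝ, 0 ≤ s → IntegrableOn (interferenceIntegrand 1 P α s) (Ioi 0)) ∧
    (∀ i, IntegrableOn
      (deliveryIntegrand 1 1 lam P α (sirThreshold c (ρ i)) (p i)) (Ioi 0)) ∧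
    -- the denominators of the closed form are positive
    (∀ i, 0 < (1 - sirThreshold c (ρ i) ^ (2 / α) * cTauAlpha (sirThreshold c (ρ i)) α) * p i
      + sirThreshold c (ρ i) ^ (2 / α) * cAlpha α) ∧
    deliveryLowerBound 1 1 lam P α c f p ρ =
      ∑ i, f i * (p i /
        ((1 - sirThreshold c (ρ i) ^ (2 / α) * cTauAlpha (sirThreshold c (ρ i)) α) * p i
          + sirThreshold c (ρ i) ^ (2 / α) * cAlpha α)) := by
  have hτ : ∀ i, 0 < sirThreshold c (ρ i) := fun i =>
    sirThreshold_pos (mul_pos (by linarith) (hρ i))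
  exact ⟨fun s hs => integrableOn_interferenceIntegrand_one hP hα hs,
    fun i => integrableOn_deliveryIntegrand_one_one hlam hP hα (hτ i) (hp0 i),
    fun i => delivery_denominator_pos hα (hτ i) (hp0 i),
    Finset.sum_congr rfl fun i _ => by
      rw [integral_deliveryIntegrand_one_one hlam hP hα (hτ i) (hp0 i)]⟩
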